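/- **B-splines generated from B-spline element bases.** Let $p\ge 1$, $M\ge 2$ be integers and $\xi_1<\xi_2<\dots<\xi_M$ real numbers. For a finite nondecreasing knot vector $\Xi=\{t_1,\dots,t_{N+p+1}\}$, the B-splines $B_1,\dots,B_N:\mathbb R\to\mathbb R$ of degree $p$ on $\Xi$ are those given by the Cox–de Boor recurrence, $B_i$ being built from the $p+2$ consecutive knots $t_i,\dots,t_{i+p+1}$ (with indicator functions of half-open intervals $[t_k,t_{k+1})$ in degree $0$, and quotients with zero denominator read as $0$); let $\mathcal B_p(\Xi)=\{B_1,\dots,B_N\}$. Write $r\,\xi$ for a knot $\xi$ repeated $r$ times. For $1\le j\le M-1$ let $K_j=(\xi_j,\xi_{j+1})$, $h_j=\xi_{j+1}-\xi_j$ and $\xi_{j,k}=\xi_j+k h_j/p$ $(0\le k\le p)$. The element basis functions $B_{K_j,1},\dots,B_{K_j,2p}$ are the B-splines of degree $p$ on the open knot vector $\Xi_{K_j}=\{(p+1)\xi_j,\ \xi_{j,1},\dots,\xi_{j,p-1},\ (p+1)\xi_{j+1}\}$. (1) Let $2\le j\le M-1$, so that $K_{j-1}$ and $K_j$ are neighbouring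 elements. Put $$B_{m,0,j}=B_{K_{j-1},2p-m},\qquad B_{m,m+1,j}=B_{K_j,m+1}\qquad(0\le m\le p-1),$$ $$B_{m,n,j}=H_{m,n-1,j}\,B_{m-1,n-1,j}+(1-H_{m,n,j})\,B_{m-1,n,j}\qquad(1\le n\le m\le p),$$ $$H_{m,n,j}=\frac{(m-n)h_{j-1}}{(m-n)h_{j-1}+n h_j}.$$ Then for all $1\le n\le m\le p$: (a) $B_{m,n,j}$ is of class $C^{m-1}$ on $\mathbb R$; in particular it is $C^{m-1}$ on $K_{j-1}\cup K_j$ and across the common knot $\xi_j$; (b) $B_{m,n,j}$ is a B-spline of degree $p$: it is the $(p-m+n)$-th B-spline on the knot vector $\{\xi_{j-1,0},\dots,\xi_{j-1,p-1},\ (p-m+1)\,\xi_j,\ \xi_{j,1},\dots,\xi_{j,p}\}$; (c) $B_{m,n,j}$ is an explicit linear combination of element basis functions, $$B_{m,n,j}=\sum_{k=0}^{m-1}\bigl(\alpha^{k}_{m,n}(h_{j-1},h_j)\,B_{K_{j-1},2p-k}+\beta^{k}_{m,n}(h_{j-1},h_j)\,B_{K_j,k+1}\bigr),$$ whose coefficients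 depend only on the two element lengths (and on $k,m,n$): for each $k$, both arrays $\alpha^k$ and $\beta^k$ satisfy the same recurrence in $(m,n)$ as $B_{m,n,j}$, with initial data $\alpha^k_{m,0}=\delta_{mk}$, $\alpha^k_{m,m+1}=0$ and $\beta^k_{m,0}=0$, $\beta^k_{m,m+1}=\delta_{mk}$. (2) Consequently every global B-spline basis function is an explicit linear combination of element basis functions: let $r_1=r_M=p+1$ and $1\le r_j\le p$ for $2\le j\le M-1$, and let $$\Xi=\{r_1\xi_1,\ \xi_{1,1},\dots,\xi_{1,p-1},\ r_2\xi_2,\ \dots,\ r_{M-1}\xi_{M-1},\ \xi_{M-1,1},\dots,\xi_{M-1,p-1},\ r_M\xi_M\}.$$ Then $$\mathcal B_p(\Xi)=\{B_{K_1,i}\}_{i=1}^{p}\ \cup\ \bigcup_{j=2}^{M-1}\mathcal B_{\xi_j,r_j}\ \cup\ \{B_{K_{M-1},i}\}_{i=p+1}^{2p},$$ where $$\mathcal B_{\xi_j,r}=\{B_{K_{j-1},i}\}_{i=p+1}^{p+r-1}\cup\{B_{p-r+1,n,j}\}_{n=1}^{p-r+1}\cup\{B_{K_j,i}\}_{i=p-r+2}^{p}.$$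 -/

import Mathlib

noncomputable section

/-- The Cox--de Boor recurrence: `coxDeBoor t q i` is the function of degree `q` attached to the
knots `t i, …, t (i + q + 1)`. Half-open intervals in degree `0`; a quotient with zero denominator
is `0`, as usual. -/
def coxDeBoor (t : ℕ → ℝ) : ℕ → ℕ → ℝ → ℝ
  | 0, i => fun x => if t i ≤ x ∧ x < t (i + 1) then 1 else 0
  | q + 1, i => fun x =>
      (x - t i) / (t (i + q + 1) - t i) * coxDeBoor t q i x
        + (t (i + q + 2) - x) / (t (i + q + 2) - t (i + 1)) * coxDeBoor t q (i + 1) x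

/-- The B-spline of degree `p` with the list `T` of its `p + 2` knots. -/
def bspline (p : ℕ) (T : List ℝ) : ℝ → ℝ :=
  coxDeBoor (fun k => T.getD k 0) p 0

/-- The `i`-th B-spline (`i = 1, …, N`, with `N = Ξ.length - (p + 1)`) of degree `p` on the knot
vector `Ξ`: the one given by the `p + 2` consecutive knots `t_i, …, t_{i+p+1}` of `Ξ`. -/
def bsplineOn (p : ℕ) (Ξ : List ℝ) (i : ℕ) : ℝ → ℝ :=
  bspline p ((Ξ.drop (i - 1)).take (p + 2))

/-- The set of all B-splines of degree `p` on the knot vector `Ξ`. -/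
def bsplineSet (p : ℕ) (Ξ : List ℝ) : Set (ℝ → ℝ) :=
  {B | ∃ i, 1 ≤ i ∧ i + (p + 1) ≤ Ξ.length ∧ B = bsplineOn p Ξ i}

/-- The length `h_j` of the element `K_j = (ξ_j, ξ_{j+1})`. -/
def elementLength (ξ : ℕ → ℝ) (j : ℕ) : ℝ := ξ (j + 1) - ξ j

/-- The knot `ξ_{j,k}`, `0 ≤ k ≤ p`, dividing `K_j` into `p` equal parts. -/
def elementNode (p : ℕ) (ξ : ℕ → ℝ) (j k : ℕ) : ℝ := ξ j + k * elementLength ξ j / p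

/-- The knots `ξ_{j,1}, …, ξ_{j,p-1}`. -/
def innerNodes (p : ℕ) (ξ : ℕ → ℝ) (j : ℕ) : List ℝ :=
  (List.range' 1 (p - 1)).map (elementNode p ξ j)

/-- The open knot vector `{(p+1) ξ_j, ξ_{j,1}, …, ξ_{j,p-1}, (p+1) ξ_{j+1}}` of `K_j`. -/
def elementKnots (p : ℕ) (ξ : ℕ → ℝ) (j : ℕ) : List ℝ :=
  List.replicate (p + 1) (ξ j) ++ innerNodes p ξ j ++ List.replicate (p + 1) (ξ (j + 1))

/-- The element basis functions `B_{K_j,i}`, `i = 1, …, 2p`. -/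
def elementBasis (p : ℕ) (ξ : ℕ → ℝ) (j i : ℕ) : ℝ → ℝ :=
  bsplineOn p (elementKnots p ξ j) i

/-- `H_{m,n} = (m-n) a / ((m-n) a + n b)`, for the lengths `a`, `b` of the left and the right
element. -/
def insertionWeight (a b : ℝ) (m n : ℕ) : ℝ :=
  ((m : ℝ) - n) * a / (((m : ℝ) - n) * a + n * b)

/-- The triangular recurrence with lateral data `L` and `R`: `X_{m,0} = L m`, `X_{m,m+1} = R m`, and
`X_{m,n} = H_{m,n-1} X_{m-1,n-1} + (1 - H_{m,n}) X_{m-1,n}` for `1 ≤ n ≤ m`. It is run in any real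
vector space; the entries with `n > m + 1` have no meaning and are never used. -/
def inverseInsertion {V : Type*} [AddCommGroup V] [Module ℝ V] (a b : ℝ) (L R : ℕ → V) :
    ℕ → ℕ → V
  | 0, n => if n = 0 then L 0 else R 0
  | m + 1, n =>
      if n = 0 then L (m + 1)
      else if n = m + 2 then R (m + 1)
      else insertionWeight a b (m + 1) (n - 1) • inverseInsertion a b L R m (n - 1)
        + (1 - insertionWeight a b (m + 1) n) • inverseInsertion a b L R m n

/-- `B_{m,n,j}`: the recurrence started from `B_{m,0,j} = B_{K_{j-1},2p-m}` and
`B_{m,m+1,j} = B_{K_j,m+1}`, `0 ≤ m ≤ p - 1`. -/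
def combinedBasis (p : ℕ) (ξ : ℕ → ℝ) (j m n : ℕ) : ℝ → ℝ :=
  inverseInsertion (elementLength ξ (j - 1)) (elementLength ξ j)
    (fun k => elementBasis p ξ (j - 1) (2 * p - k)) (fun k => elementBasis p ξ j (k + 1)) m n

/-- The coefficient of `B_{K_{j-1},2p-k}` in `B_{m,n,j}`, as a function of the two lengths: the same
recurrence, run on real numbers. -/
def leftCoeff (a b : ℝ) (k m n : ℕ) : ℝ :=
  inverseInsertion a b (fun i => if i = k then (1 : ℝ) else 0) (fun _ => 0) m n

/-- The coefficient of `B_{K_j,k+1}` in `B_{m,n,j}`, as a function of the two lengths. -/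
def rightCoeff (a b : ℝ) (k m n : ℕ) : ℝ :=
  inverseInsertion a b (fun _ => (0 : ℝ)) (fun i => if i = k then 1 else 0) m n

/-- The knot vector `{ξ_{j-1,0}, …, ξ_{j-1,p-1}, r ξ_j, ξ_{j,1}, …, ξ_{j,p}}` on two neighbouring
elements, with `ξ_j` repeated `r` times and all other knots simple. -/
def pairKnots (p : ℕ) (ξ : ℕ → ℝ) (j r : ℕ) : List ℝ :=
  (List.range p).map (elementNode p ξ (j - 1)) ++ List.replicate r (ξ j)
    ++ (List.range' 1 p).map (elementNode p ξ j)

/-- The global knot vector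
`{r_1 ξ_1, ξ_{1,1}, …, ξ_{1,p-1}, r_2 ξ_2, …, ξ_{M-1,1}, …, ξ_{M-1,p-1}, r_M ξ_M}`. -/
def globalKnots (p M : ℕ) (ξ : ℕ → ℝ) (r : ℕ → ℕ) : List ℝ :=
  List.replicate (r 1) (ξ 1) ++
    (List.range' 1 (M - 1)).flatMap
      (fun j => innerNodes p ξ j ++ List.replicate (r (j + 1)) (ξ (j + 1)))

/-- The family attached to an interior knot `ξ_j` of multiplicity `r`:
`B_{K_{j-1},p+1}, …, B_{K_{j-1},p+r-1}`, then `B_{p-r+1,1,j}, …, B_{p-r+1,p-r+1,j}`, then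
`B_{K_j,p-r+2}, …, B_{K_j,p}`. -/
def knotBasis (p : ℕ) (ξ : ℕ → ℝ) (j r : ℕ) : Set (ℝ → ℝ) :=
  elementBasis p ξ (j - 1) '' Set.Icc (p + 1) (p + r - 1)
    ∪ combinedBasis p ξ j (p - r + 1) '' Set.Icc 1 (p - r + 1)
    ∪ elementBasis p ξ j '' Set.Icc (p - r + 2) p

end

/-!
The recurrence for `B_{m,n}` is knot insertion read backwards. Let `M_q` be the B-spline of degree
`q` divided by the length of its support (`scaledSpline`). On a nondecreasing knot sequence
`T = (t_0, …, t_{q+2})` one has, for every `k`,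
`(t_{q+2} - t_0) M_q(T ∖ t_k) = (t_k - t_0) M_q(T ∖ t_{q+2}) + (t_{q+2} - t_k) M_q(T ∖ t_0)`
(`scaledSpline_removeKnot`), by induction on `q`; the right-hand side with `x` in place of `t_k` is
the Cox--de Boor recurrence for the B-spline of degree `q + 1` on `T`.

When `T` consists of nodes of two neighbouring elements and `t_k` is one of the copies of the common
knot, the two coefficients are exactly `H_{m,n-1}` and `1 - H_{m,n}`. Since the lateral data
are the B-splines with enough copies of the common knot, `B_{m,n}` is the B-spline with `m + 1 - n`
knots on the left, `p + 1 - m` copies of `ξ_j` and `n` knots on the right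
(`combinedBasis_eq_coxDeBoor`). The coefficient formula is linearity of the recurrence
(`inverseInsertion_eq_sum`).

For smoothness, subtracting the two formulas above expresses a B-spline of degree `q + 1` near a
knot `t_k` as one of degree `q` with `t_k` removed, plus `x - t_k` times a difference of scaled
B-splines. Removing the knot lowers its multiplicity, so induction on the degree gives continuity
and the derivative formula at every point of multiplicity at most `q + 1` and `q`, respectively
(`coxDeBoor_continuousAt`, `coxDeBoor_hasDerivAt`), and iterating the latter gives
`coxDeBoor_contDiff`.

For the global knot vector, each window of `p + 2` consecutive knots either lies in one closed
element or has an interior knot `ξ_j` with all of its copies between nodes of the two adjacent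
elements. In the first case the window also occurs in the open knot vector of the element
(`bsplineOn_globalKnots_element`), in the second in the knot vector of the pair of elements
(`bsplineOn_globalKnots_pair`).
-/

open Filter Topology

/-! ### Removing a knot from a B-spline -/

/-- The knot sequence `t` with the knot `t k` removed. -/
noncomputable def removeKnot (t : ℕ → ℝ) (k : ℕ) : ℕ → ℝ :=
  fun i => if i < k then t i else t (i + 1)

/-- The B-spline divided by the length of its support: for `t i < t (i + q + 1)` this is, up to a
factor depending on `q` only, the B-spline with integral one; it is `0` if all knots coincide. -/
noncomputable def scaledSpline (t : ℕ → ℝ) (q i : ℕ) (x : ℝ) : ℝ :=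
  coxDeBoor t q i x / (t (i + q + 1) - t i)

/-- How often `x` occurs among the `q + 2` knots `t i, …, t (i + q + 1)`. -/
noncomputable def knotMultiplicity (t : ℕ → ℝ) (q i : ℕ) (x : ℝ) : ℕ :=
  ((Finset.Ico i (i + q + 2)).filter (fun j => t j = x)).card

theorem coxDeBoor_congr {t s : ℕ → ℝ} {q i i' : ℕ} (h : ∀ k, k ≤ q + 1 → t (i + k) = s (i' + k)) :
    coxDeBoor t q i = coxDeBoor s q i' := by
  induction q generalizing i i' with
  | zero =>
    have h0 := h 0 (by omega)
    have h1 := h 1 (by omega)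
    simp only [add_zero] at h0
    simp only [coxDeBoor, h0, h1]
  | succ q ih =>
    have e1 := ih (i := i) (i' := i') (fun k hk => h k (by omega))
    have e2 := ih (i := i + 1) (i' := i' + 1) (fun k hk => by
      have := h (k + 1) (by omega)
      rw [show i + 1 + k = i + (k + 1) by omega, this]
      congr 1; omega)
    have h0 := h 0 (by omega)
    have h1 := h 1 (by omega)
    have h2 := h (q + 1) (by omega)
    have h3 := h (q + 2) (by omega)
    simp only [add_zero] at h0
    simp only [coxDeBoor, e1, e2, h0, h1, add_assoc] at *
    simp only [h2, h3]

theorem scaledSpline_congr {t s : ℕ → ℝ} {q i i' : ℕ}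
    (h : ∀ k, k ≤ q + 1 → t (i + k) = s (i' + k)) (x : ℝ) :
    scaledSpline t q i x = scaledSpline s q i' x := by
  have h0 := h 0 (by omega)
  have h1 := h (q + 1) le_rfl
  simp only [add_zero] at h0
  simp only [scaledSpline, coxDeBoor_congr h, add_assoc, h0, h1]

theorem coxDeBoor_succ (t : ℕ → ℝ) (q i : ℕ) (x : ℝ) :
    coxDeBoor t (q + 1) i x =
      (x - t i) * scaledSpline t q i x + (t (i + q + 2) - x) * scaledSpline t q (i + 1) x := by
  simp only [coxDeBoor, scaledSpline, show i + 1 + q + 1 = i + q + 2 by omega]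
  ring

theorem scaledSpline_succ (t : ℕ → ℝ) (q i : ℕ) (x : ℝ) :
    scaledSpline t (q + 1) i x =
      ((x - t i) * scaledSpline t q i x + (t (i + q + 2) - x) * scaledSpline t q (i + 1) x)
        / (t (i + q + 2) - t i) := by
  rw [scaledSpline, coxDeBoor_succ]
  rfl

theorem removeKnot_monotone {t : ℕ → ℝ} (ht : Monotone t) (k : ℕ) : Monotone (removeKnot t k) := by
  refine monotone_nat_of_le_succ fun i => ?_
  unfold removeKnot
  split_ifs <;> first | omega | exact ht (by omega)

theorem scaledSpline_eq_zero {t : ℕ → ℝ} {q i : ℕ} (h : t (i + q + 1) = t i) (x : ℝ) :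
    scaledSpline t q i x = 0 := by
  simp [scaledSpline, h]

theorem coxDeBoor_eq_zero {t : ℕ → ℝ} (ht : Monotone t) {q i : ℕ} (h : t (i + q + 1) = t i)
    (x : ℝ) : coxDeBoor t q i x = 0 := by
  cases q with
  | zero =>
    simp only [add_zero] at h
    simp [coxDeBoor, h]
  | succ q =>
    have h1 : t (i + q + 1) = t i :=
      le_antisymm (h ▸ ht (by omega)) (ht (by omega))
    have h2 : t (i + 1 + q + 1) = t (i + 1) :=
      le_antisymm (by rw [show i + 1 + q + 1 = i + (q + 1) + 1 by omega, h]; exact ht (by omega))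
        (ht (by omega))
    rw [coxDeBoor_succ, scaledSpline_eq_zero h1, scaledSpline_eq_zero h2]; ring

theorem scaledSpline_eq_zero_of_le {t : ℕ → ℝ} (ht : Monotone t) {a b q i : ℕ} (hab : t b ≤ t a)
    (ha : a ≤ i) (hb : i + q + 1 ≤ b) (x : ℝ) : scaledSpline t q i x = 0 :=
  scaledSpline_eq_zero (le_antisymm ((ht hb).trans (hab.trans (ht ha))) (ht (by omega))) x

theorem scaledSpline_removeKnot_eq_zero_of_le {t : ℕ → ℝ} (ht : Monotone t) {a b q i : ℕ} (k : ℕ)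
    (hab : t b ≤ t a) (ha : a ≤ i) (hb : i + q + 2 ≤ b) (x : ℝ) :
    scaledSpline (removeKnot t k) q i x = 0 := by
  have h1 : t i ≤ removeKnot t k i := by
    unfold removeKnot
    split_ifs <;> exact ht (by omega)
  have h2 : removeKnot t k (i + q + 1) ≤ t (i + q + 2) := by
    unfold removeKnot
    split_ifs <;> exact ht (by omega)
  exact scaledSpline_eq_zero (le_antisymm
    (h2.trans ((ht hb).trans (hab.trans ((ht ha).trans h1))))
    (removeKnot_monotone ht k (by omega))) x

theorem mul_scaledSpline {t : ℕ → ℝ} (ht : Monotone t) (q i : ℕ) (x : ℝ) :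
    (t (i + q + 1) - t i) * scaledSpline t q i x = coxDeBoor t q i x := by
  by_cases h : t (i + q + 1) = t i
  · rw [coxDeBoor_eq_zero ht h, scaledSpline_eq_zero h]; ring
  · rw [scaledSpline, mul_div_cancel₀]
    exact sub_ne_zero.2 h

theorem scaledSpline_removeKnot_of_le (t : ℕ → ℝ) {k q i : ℕ} (h : k ≤ i) (x : ℝ) :
    scaledSpline (removeKnot t k) q i x = scaledSpline t q (i + 1) x :=
  scaledSpline_congr (fun l _ => by
    rw [removeKnot, if_neg (by omega)]; congr 1; omega) x

theorem scaledSpline_removeKnot_of_lt (t : ℕ → ℝ) {k q i : ℕ} (h : i + q + 1 < k) (x : ℝ) :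
    scaledSpline (removeKnot t k) q i x = scaledSpline t q i x :=
  scaledSpline_congr (fun l _ => by rw [removeKnot, if_pos (by omega)]) x

/-- Knot insertion in symmetric form: among `q + 3` consecutive knots, the scaled B-spline on all
but `t k` is the affine combination of those on all but the last and on all but the first. The
recurrence for the B-spline of degree `q + 1` is the same expression with `t k` replaced by `x`. -/
theorem scaledSpline_removeKnot {t : ℕ → ℝ} (ht : Monotone t) (k q i : ℕ) (hi : i ≤ k)
    (hk : k ≤ i + q + 2) (x : ℝ) :
    (t (i + q + 2) - t i) * scaledSpline (removeKnot t k) q i x =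
      (t k - t i) * scaledSpline t q i x + (t (i + q + 2) - t k) * scaledSpline t q (i + 1) x := by
  rcases hi.eq_or_lt with rfl | hi
  · rw [scaledSpline_removeKnot_of_le t le_rfl]; ring
  rcases hk.eq_or_lt with rfl | hk
  · rw [scaledSpline_removeKnot_of_lt t (by omega)]; ring
  have e0 : removeKnot t k i = t i := by rw [removeKnot, if_pos hi]
  have e1 : removeKnot t k (i + q + 1) = t (i + q + 2) := by rw [removeKnot, if_neg (by omega)]
  have key : (t (i + q + 2) - t i) * scaledSpline (removeKnot t k) q i x
      = coxDeBoor (removeKnot t k) q i x := by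
    rw [← mul_scaledSpline (removeKnot_monotone ht k), e0, e1]
  rw [key]
  clear key
  induction q generalizing i with
  | zero =>
    obtain rfl : k = i + 1 := by omega
    have h1 := mul_scaledSpline ht 0 i x
    have h2 := mul_scaledSpline ht 0 (i + 1) x
    simp only [add_zero] at h1 h2 ⊢
    rw [show i + 2 = i + 1 + 1 by omega, h1, h2]
    simp only [coxDeBoor, removeKnot, if_pos (Nat.lt_succ_self i), if_neg (lt_irrefl (i + 1))]
    have a1 := ht (show i ≤ i + 1 by omega)
    have a2 := ht (show i + 1 ≤ i + 1 + 1 by omega)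
    split_ifs <;> first | (exfalso; grind) | simp
  | succ q ih =>
    have hA : (t (i + q + 2) - t i) * scaledSpline (removeKnot t k) q i x =
      (t k - t i) * scaledSpline t q i x + (t (i + q + 2) - t k) * scaledSpline t q (i + 1) x := by
      rcases eq_or_lt_of_le (show k ≤ i + q + 2 by omega) with rfl | hk'
      · rw [scaledSpline_removeKnot_of_lt t (by omega)]; ring
      · have e1 : removeKnot t k (i + q + 1) = t (i + q + 2) := by
          rw [removeKnot, if_neg (by omega)]
        rw [← ih i hi.le hk'.le hi hk' e0 e1, ← mul_scaledSpline (removeKnot_monotone ht k), e0, e1]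
    have hB : (t (i + q + 3) - t (i + 1)) * scaledSpline (removeKnot t k) q (i + 1) x =
      (t k - t (i + 1)) * scaledSpline t q (i + 1) x
        + (t (i + q + 3) - t k) * scaledSpline t q (i + 2) x := by
      rcases eq_or_lt_of_le (show i + 1 ≤ k by omega) with rfl | hi'
      · rw [scaledSpline_removeKnot_of_le t le_rfl]; ring
      · have e0 : removeKnot t k (i + 1) = t (i + 1) := by rw [removeKnot, if_pos hi']
        have e1 : removeKnot t k (i + 1 + q + 1) = t (i + 1 + q + 2) := by
          rw [removeKnot, if_neg (by omega)]
        have := ih (i + 1) hi'.le (by omega) hi' (by omega) e0 e1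
        rw [← mul_scaledSpline (removeKnot_monotone ht k), e0, e1] at this
        rw [show i + q + 3 = i + 1 + q + 2 by omega]
        exact this
    -- the two sides agree once multiplied out; a vanishing divisor makes its summands vanish
    rw [coxDeBoor_succ, e0, show i + q + 2 = i + (q + 1) + 1 by omega, e1]
    simp only [scaledSpline_succ]
    simp only [show i + (q + 1) + 2 = i + q + 3 by omega,
      show i + 1 + q + 2 = i + q + 3 by omega,
      show i + 1 + 1 = i + 2 by omega]
    have zA (h : t (i + q + 2) = t i) :
        scaledSpline (removeKnot t k) q i x = 0 ∧ scaledSpline t q (i + 1) x = 0 :=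
      ⟨scaledSpline_removeKnot_eq_zero_of_le ht k h.le le_rfl le_rfl x,
        scaledSpline_eq_zero_of_le ht h.le (by omega) (by omega) x⟩
    have zB (h : t (i + q + 3) = t (i + 1)) :
        scaledSpline (removeKnot t k) q (i + 1) x = 0 ∧ scaledSpline t q (i + 1) x = 0 :=
      ⟨scaledSpline_removeKnot_eq_zero_of_le ht k h.le le_rfl (by omega) x,
        scaledSpline_eq_zero_of_le ht h.le (by omega) (by omega) x⟩
    generalize scaledSpline (removeKnot t k) q i x = P at *
    generalize scaledSpline (removeKnot t k) q (i + 1) x = Q at *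
    generalize scaledSpline t q i x = A at *
    generalize scaledSpline t q (i + 1) x = B at *
    generalize scaledSpline t q (i + 2) x = C at *
    have h1 : (x - t i) * P = (t k - t i) * (((x - t i) * A + (t (i + q + 2) - x) * B)
        / (t (i + q + 2) - t i)) + (x - t k) * B := by
      by_cases h : t (i + q + 2) = t i
      · obtain ⟨rfl, rfl⟩ := zA h
        simp [h]
      · have hne : t (i + q + 2) - t i ≠ 0 := sub_ne_zero.2 h
        field_simp
        linear_combination (x - t i) * hA
    have h2 : (t (i + q + 3) - x) * Q = (t (i + q + 3) - t k) *
        (((x - t (i + 1)) * B + (t (i + q + 3) - x) * C) / (t (i + q + 3) - t (i + 1)))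
          - (x - t k) * B := by
      by_cases h : t (i + q + 3) = t (i + 1)
      · obtain ⟨rfl, rfl⟩ := zB h
        simp [h]
      · have hne : t (i + q + 3) - t (i + 1) ≠ 0 := sub_ne_zero.2 h
        field_simp
        linear_combination (t (i + q + 3) - x) * hB
    linear_combination h1 + h2

/-- A B-spline differs from the one of lower degree without the knot `t k` by a term that vanishes
at `t k`; this is what makes induction on the degree work at a multiple knot. If `t k` is an
interior knot, the first summand is the B-spline without `t k`. -/
theorem coxDeBoor_succ_eq_removeKnot {t : ℕ → ℝ} (ht : Monotone t) (k q i : ℕ) (hi : i ≤ k)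
    (hk : k ≤ i + q + 2) (x : ℝ) :
    coxDeBoor t (q + 1) i x =
      (t (i + q + 2) - t i) * scaledSpline (removeKnot t k) q i x
        + (x - t k) * (scaledSpline t q i x - scaledSpline t q (i + 1) x) := by
  rw [scaledSpline_removeKnot ht k q i hi hk, coxDeBoor_succ]; ring

/-- At the knot `t k`, one occurrence of `t k` may be dropped and the degree lowered. -/
theorem scaledSpline_succ_at_knot {t : ℕ → ℝ} (ht : Monotone t) {k q i : ℕ} (hi : i ≤ k)
    (hk : k ≤ i + q + 2) :
    scaledSpline t (q + 1) i (t k) = scaledSpline (removeKnot t k) q i (t k) := by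
  by_cases h : t (i + q + 2) = t i
  · rw [scaledSpline_removeKnot_eq_zero_of_le ht k h.le le_rfl le_rfl,
      scaledSpline_eq_zero_of_le ht h.le le_rfl (by omega)]
  · rw [scaledSpline_succ, ← scaledSpline_removeKnot ht k q i hi hk,
      mul_div_cancel_left₀ _ (sub_ne_zero.2 h)]

/-- The difference that gives the derivative at the knot `t k`, in terms of the remaining knots. The
quotient of the two lengths differs from one only if `t k` is the first or the last knot. -/
theorem scaledSpline_sub_at_knot {t : ℕ → ℝ} (ht : Monotone t) {k q i : ℕ} (hi : i ≤ k)
    (hk : k ≤ i + q + 3) :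
    (t (i + q + 3) - t i) / (removeKnot t k (i + q + 2) - removeKnot t k i) *
        (scaledSpline (removeKnot t k) q i (t k) - scaledSpline (removeKnot t k) q (i + 1) (t k)) =
      scaledSpline t (q + 1) i (t k) - scaledSpline t (q + 1) (i + 1) (t k) := by
  rcases hi.eq_or_lt with rfl | hi'
  · rw [scaledSpline_succ_at_knot ht le_rfl (by omega), scaledSpline_removeKnot_of_le t le_rfl,
      scaledSpline_removeKnot_of_le t (by omega), scaledSpline_succ, removeKnot, removeKnot,
      if_neg (by omega), if_neg (by omega)]
    simp only [show i + 1 + q + 2 = i + q + 3 by omega, show i + q + 2 + 1 = i + q + 3 by omega]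
    by_cases h : t (i + q + 3) = t (i + 1)
    · rw [scaledSpline_eq_zero_of_le ht h.le le_rfl (by omega)]
      simp [h]
    · have hne : t (i + q + 3) - t (i + 1) ≠ 0 := sub_ne_zero.2 h
      field_simp
      ring
  rcases hk.eq_or_lt with rfl | hk'
  · rw [scaledSpline_succ_at_knot ht (i := i + 1) (by omega) (by omega),
      scaledSpline_removeKnot_of_lt t (by omega), scaledSpline_removeKnot_of_lt t (by omega),
      scaledSpline_succ, removeKnot, removeKnot, if_pos (by omega), if_pos (by omega)]
    by_cases h : t (i + q + 2) = t i
    · rw [scaledSpline_eq_zero_of_le ht h.le (by omega) (by omega) (i := i + 1)]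
      simp [h]
    · have hne : t (i + q + 2) - t i ≠ 0 := sub_ne_zero.2 h
      field_simp
      ring
  · rw [scaledSpline_succ_at_knot ht hi (by omega),
      scaledSpline_succ_at_knot ht (i := i + 1) hi' (by omega), removeKnot, removeKnot,
      if_neg (by omega), if_pos (by omega), show i + q + 2 + 1 = i + q + 3 by omega]
    by_cases h : t (i + q + 3) = t i
    · rw [scaledSpline_removeKnot_eq_zero_of_le ht k h.le le_rfl (by omega),
        scaledSpline_removeKnot_eq_zero_of_le ht k h.le (by omega) (by omega)]
      simp
    · rw [div_self (sub_ne_zero.2 h), one_mul]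

/-! ### Continuity and derivatives of B-splines -/

theorem knotMultiplicity_mono {t : ℕ → ℝ} {q q' i i' : ℕ} (hi : i' ≤ i)
    (hq : i + q ≤ i' + q') (x : ℝ) : knotMultiplicity t q i x ≤ knotMultiplicity t q' i' x := by
  refine Finset.card_le_card (Finset.filter_subset_filter _ fun j hj => ?_)
  simp only [Finset.mem_Ico] at hj ⊢
  omega

theorem knotMultiplicity_eq_zero_iff {t : ℕ → ℝ} {q i : ℕ} {x : ℝ} :
    knotMultiplicity t q i x = 0 ↔ ∀ j, i ≤ j → j < i + q + 2 → t j ≠ x := by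
  simp only [knotMultiplicity, Finset.card_eq_zero, Finset.filter_eq_empty_iff, Finset.mem_Ico,
    and_imp, ne_eq]

theorem knotMultiplicity_removeKnot_lt {t : ℕ → ℝ} {k q i : ℕ} (hi : i ≤ k) (hk : k ≤ i + q + 2) :
    knotMultiplicity (removeKnot t k) q i (t k) < knotMultiplicity t (q + 1) i (t k) := by
  have hmem : k ∈ (Finset.Ico i (i + (q + 1) + 2)).filter (fun j => t j = t k) := by
    simp only [Finset.mem_filter, Finset.mem_Ico]
    exact ⟨by omega, trivial⟩
  rw [knotMultiplicity, knotMultiplicity, ← Finset.card_erase_add_one hmem, Nat.lt_succ_iff]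
  refine Finset.card_le_card_of_injOn (fun j => if j < k then j else j + 1) ?_ ?_
  · intro j hj
    obtain ⟨hj, hx⟩ := Finset.mem_filter.1 (Finset.mem_coe.1 hj)
    rw [Finset.mem_Ico] at hj
    refine Finset.mem_coe.2 (Finset.mem_erase.2 ⟨?_, Finset.mem_filter.2 ⟨?_, ?_⟩⟩)
    all_goals dsimp only
    · split_ifs <;> omega
    · rw [Finset.mem_Ico]
      split_ifs <;> omega
    · unfold removeKnot at hx
      split_ifs at hx ⊢ <;> exact hx
  · intro j _ l _ h
    simp only at h
    split_ifs at h <;> omega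

theorem coxDeBoor_isBigO_one (t : ℕ → ℝ) (q i : ℕ) (x₀ : ℝ) :
    coxDeBoor t q i =O[𝓝 x₀] (fun _ => (1 : ℝ)) := by
  induction q generalizing i with
  | zero =>
    refine Asymptotics.IsBigO.of_bound 1 (Eventually.of_forall fun x => ?_)
    simp only [coxDeBoor]
    split_ifs <;> simp
  | succ q ih =>
    have h1 : (fun x => (x - t i) / (t (i + q + 1) - t i)) =O[𝓝 x₀] (fun _ => (1 : ℝ)) :=
      (show ContinuousAt _ x₀ by fun_prop).tendsto.isBigO_one ℝ
    have h2 : (fun x => (t (i + q + 2) - x) / (t (i + q + 2) - t (i + 1)))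
        =O[𝓝 x₀] (fun _ => (1 : ℝ)) :=
      (show ContinuousAt _ x₀ by fun_prop).tendsto.isBigO_one ℝ
    simpa only [coxDeBoor, mul_one] using (h1.mul (ih i)).add (h2.mul (ih (i + 1)))

theorem coxDeBoor_zero_eventuallyEq {t : ℕ → ℝ} {i : ℕ} {x₀ : ℝ} (h0 : t i ≠ x₀)
    (h1 : t (i + 1) ≠ x₀) : coxDeBoor t 0 i =ᶠ[𝓝 x₀] fun _ => coxDeBoor t 0 i x₀ := by
  have e : ∀ a : ℝ, a ≠ x₀ → ∀ᶠ x in 𝓝 x₀, (a ≤ x ↔ a ≤ x₀) ∧ (x < a ↔ x₀ < a) := by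
    intro a ha
    rcases ha.lt_or_gt with h | h
    · filter_upwards [lt_mem_nhds h] with x hx
      exact ⟨⟨fun _ => h.le, fun _ => hx.le⟩,
        ⟨fun h' => absurd hx h'.not_gt, fun h' => absurd h h'.not_gt⟩⟩
    · filter_upwards [gt_mem_nhds h] with x hx
      exact ⟨⟨fun h' => absurd hx h'.not_gt, fun h' => absurd h h'.not_gt⟩,
        ⟨fun _ => h, fun _ => hx⟩⟩
  filter_upwards [e _ h0, e _ h1] with x hx0 hx1
  simp only [coxDeBoor, hx0.1, hx1.2]

theorem coxDeBoor_continuousAt {t : ℕ → ℝ} (ht : Monotone t) {q i : ℕ} {x₀ : ℝ}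
    (h : knotMultiplicity t q i x₀ ≤ q) : ContinuousAt (coxDeBoor t q i) x₀ := by
  induction q generalizing i t with
  | zero =>
    rw [Nat.le_zero, knotMultiplicity_eq_zero_iff] at h
    exact (continuousAt_congr (coxDeBoor_zero_eventuallyEq (h i (by omega) (by omega))
      (h (i + 1) (by omega) (by omega)))).2 continuousAt_const
  | succ q ih =>
    by_cases h0 : knotMultiplicity t (q + 1) i x₀ = 0
    · have c1 : ContinuousAt (coxDeBoor t q i) x₀ :=
        ih ht ((knotMultiplicity_mono le_rfl (by omega) x₀).trans (h0.le.trans (by omega)))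
      have c2 : ContinuousAt (coxDeBoor t q (i + 1)) x₀ :=
        ih ht ((knotMultiplicity_mono (by omega) (by omega) x₀).trans (h0.le.trans (by omega)))
      simp only [coxDeBoor]
      fun_prop
    · rw [knotMultiplicity_eq_zero_iff] at h0
      push Not at h0
      obtain ⟨k, hi, hk, rfl⟩ := h0
      have hk' : k ≤ i + q + 2 := by omega
      -- near `t k` the B-spline is one of lower multiplicity, plus a term `O(x - t k)`
      have c1 : ContinuousAt (coxDeBoor (removeKnot t k) q i) (t k) :=
        ih (removeKnot_monotone ht k)
          (by have := knotMultiplicity_removeKnot_lt (t := t) hi hk'; omega)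
      have c2 : ContinuousAt (fun x => (x - t k) *
          (scaledSpline t q i x - scaledSpline t q (i + 1) x)) (t k) := by
        have b : ∀ j, (fun x => scaledSpline t q j x) =O[𝓝 (t k)] (fun _ => (1 : ℝ)) := by
          intro j
          have := (coxDeBoor_isBigO_one t q j (t k)).const_mul_left (t (j + q + 1) - t j)⁻¹
          simpa only [scaledSpline, div_eq_inv_mul] using this
        have l : (fun x => x - t k) =o[𝓝 (t k)] (fun _ => (1 : ℝ)) := by
          rw [Asymptotics.isLittleO_one_iff]
          have : ContinuousAt (fun x => x - t k) (t k) := by fun_prop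
          simpa [ContinuousAt] using this
        have := l.mul_isBigO ((b i).sub (b (i + 1)))
        simp only [mul_one, Asymptotics.isLittleO_one_iff] at this
        simpa [ContinuousAt] using this
      have e : coxDeBoor t (q + 1) i = fun x =>
          (t (i + q + 2) - t i) * scaledSpline (removeKnot t k) q i x
            + (x - t k) * (scaledSpline t q i x - scaledSpline t q (i + 1) x) :=
        funext (coxDeBoor_succ_eq_removeKnot ht k q i hi hk')
      rw [e]
      refine ContinuousAt.add (ContinuousAt.mul continuousAt_const ?_) c2
      unfold scaledSpline
      fun_prop

/-- Only continuity of the cofactor is needed at the zero of `x - a`. -/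
theorem hasDerivAt_sub_mul_of_continuousAt {g : ℝ → ℝ} {a : ℝ} (hg : ContinuousAt g a) :
    HasDerivAt (fun x => (x - a) * g x) (g a) a := by
  rw [hasDerivAt_iff_tendsto_slope]
  refine (hg.tendsto.mono_left nhdsWithin_le_nhds).congr' ?_
  filter_upwards [self_mem_nhdsWithin] with x hx
  have : x - a ≠ 0 := sub_ne_zero.2 hx
  simp only [slope, sub_self, zero_mul, sub_zero, vsub_eq_sub, smul_eq_mul]
  field_simp

/-- The derivative of a B-spline, also at knots. At a knot `t k` the factor `x - t k` contributes
the value of the continuous difference of scaled B-splines, and the B-spline without `t k` has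
lower degree and multiplicity; away from the knots the recurrence is differentiated. -/
theorem coxDeBoor_hasDerivAt {t : ℕ → ℝ} (ht : Monotone t) {q i : ℕ} {x₀ : ℝ}
    (h : knotMultiplicity t (q + 1) i x₀ ≤ q) :
    HasDerivAt (coxDeBoor t (q + 1) i)
      ((q + 1) * (scaledSpline t q i x₀ - scaledSpline t q (i + 1) x₀)) x₀ := by
  induction q generalizing i t with
  | zero =>
    rw [Nat.le_zero, knotMultiplicity_eq_zero_iff] at h
    have d1 : HasDerivAt (coxDeBoor t 0 i) 0 x₀ :=
      (hasDerivAt_const x₀ _).congr_of_eventuallyEq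
        (coxDeBoor_zero_eventuallyEq (h i (by omega) (by omega)) (h (i + 1) (by omega) (by omega)))
    have d2 : HasDerivAt (coxDeBoor t 0 (i + 1)) 0 x₀ :=
      (hasDerivAt_const x₀ _).congr_of_eventuallyEq
        (coxDeBoor_zero_eventuallyEq (h (i + 1) (by omega) (by omega))
          (h (i + 1 + 1) (by omega) (by omega)))
    have := ((((hasDerivAt_id x₀).sub_const (t i)).div_const (t (i + 0 + 1) - t i)).mul d1).add
      ((((hasDerivAt_id x₀).const_sub (t (i + 0 + 2))).div_const
        (t (i + 0 + 2) - t (i + 1))).mul d2)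
    refine HasDerivAt.congr_deriv this ?_
    simp [scaledSpline]
    ring
  | succ q ih =>
    by_cases h0 : knotMultiplicity t (q + 2) i x₀ = 0
    · have d1 := ih (i := i) ht ((knotMultiplicity_mono (by omega) (by omega) x₀).trans
        (h0.le.trans (by omega)))
      have d2 := ih (i := i + 1) ht ((knotMultiplicity_mono (by omega) (by omega) x₀).trans
        (h0.le.trans (by omega)))
      have := ((((hasDerivAt_id x₀).sub_const (t i)).div_const (t (i + (q + 1) + 1) - t i)).mul
        d1).add ((((hasDerivAt_id x₀).const_sub (t (i + (q + 1) + 2))).div_const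
        (t (i + (q + 1) + 2) - t (i + 1))).mul d2)
      refine HasDerivAt.congr_deriv this ?_
      simp only [id_eq, scaledSpline_succ, coxDeBoor_succ]
      simp only [show i + (q + 1) + 1 = i + q + 2 by omega,
        show i + (q + 1) + 2 = i + q + 3 by omega,
        show i + 1 + q + 2 = i + q + 3 by omega,
        show i + 1 + 1 = i + 2 by omega]
      have zA (h : t (i + q + 2) = t i) :
          scaledSpline t q i x₀ = 0 ∧ scaledSpline t q (i + 1) x₀ = 0 :=
        ⟨scaledSpline_eq_zero_of_le ht h.le le_rfl (by omega) x₀,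
          scaledSpline_eq_zero_of_le ht h.le (by omega) (by omega) x₀⟩
      have zB (h : t (i + q + 3) = t (i + 1)) :
          scaledSpline t q (i + 1) x₀ = 0 ∧ scaledSpline t q (i + 2) x₀ = 0 :=
        ⟨scaledSpline_eq_zero_of_le ht h.le le_rfl (by omega) x₀,
          scaledSpline_eq_zero_of_le ht h.le (by omega) (by omega) x₀⟩
      generalize scaledSpline t q i x₀ = A at *
      generalize scaledSpline t q (i + 1) x₀ = B at *
      generalize scaledSpline t q (i + 2) x₀ = C at *
      have h1 : (x₀ - t i) / (t (i + q + 2) - t i) * (A - B) =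
          ((x₀ - t i) * A + (t (i + q + 2) - x₀) * B) / (t (i + q + 2) - t i) - B := by
        by_cases h : t (i + q + 2) = t i
        · obtain ⟨rfl, rfl⟩ := zA h
          simp
        · have hne : t (i + q + 2) - t i ≠ 0 := sub_ne_zero.2 h
          field_simp
          ring
      have h2 : (t (i + q + 3) - x₀) / (t (i + q + 3) - t (i + 1)) * (B - C) =
          B - ((x₀ - t (i + 1)) * B + (t (i + q + 3) - x₀) * C)
            / (t (i + q + 3) - t (i + 1)) := by
        by_cases h : t (i + q + 3) = t (i + 1)
        · obtain ⟨rfl, rfl⟩ := zB h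
          simp
        · have hne : t (i + q + 3) - t (i + 1) ≠ 0 := sub_ne_zero.2 h
          field_simp
          ring
      push_cast
      linear_combination (q + 1 : ℝ) * h1 + (q + 1 : ℝ) * h2
    · rw [knotMultiplicity_eq_zero_iff] at h0
      push Not at h0
      obtain ⟨k, hi, hk, rfl⟩ := h0
      have hk' : k ≤ i + (q + 1) + 2 := by omega
      have lt := knotMultiplicity_removeKnot_lt (t := t) hi hk'
      have d1 := ih (i := i) (removeKnot_monotone ht k) (by omega)
      have c1 : ContinuousAt (coxDeBoor t (q + 1) i) (t k) := coxDeBoor_continuousAt ht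
        ((knotMultiplicity_mono (by omega) (by omega) _).trans h)
      have c2 : ContinuousAt (coxDeBoor t (q + 1) (i + 1)) (t k) := coxDeBoor_continuousAt ht
        ((knotMultiplicity_mono (by omega) (by omega) _).trans h)
      have d2 := hasDerivAt_sub_mul_of_continuousAt (a := t k)
        (g := fun x => scaledSpline t (q + 1) i x - scaledSpline t (q + 1) (i + 1) x)
        (by unfold scaledSpline; fun_prop)
      have e : coxDeBoor t (q + 2) i = fun x =>
          (t (i + q + 3) - t i) / (removeKnot t k (i + (q + 1) + 1) - removeKnot t k i) *
              coxDeBoor (removeKnot t k) (q + 1) i x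
            + (x - t k) * (scaledSpline t (q + 1) i x - scaledSpline t (q + 1) (i + 1) x) := by
        funext x
        rw [coxDeBoor_succ_eq_removeKnot ht k (q + 1) i hi hk', scaledSpline]
        ring_nf
      rw [e]
      refine HasDerivAt.congr_deriv ((d1.const_mul _).add d2) ?_
      have := scaledSpline_sub_at_knot ht (q := q) hi hk'
      push_cast
      linear_combination (q + 1 : ℝ) * this

/-- A B-spline of degree `q` is of class `C^(q - r)` if no knot is repeated more than `r` times. -/
theorem coxDeBoor_contDiff {t : ℕ → ℝ} (ht : Monotone t) {n q i : ℕ}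
    (h : ∀ x, knotMultiplicity t q i x + n ≤ q) : ContDiff ℝ n (coxDeBoor t q i) := by
  induction n generalizing q i with
  | zero =>
    rw [Nat.cast_zero, contDiff_zero, continuous_iff_continuousAt]
    exact fun x => coxDeBoor_continuousAt ht (h x)
  | succ n ih =>
    obtain ⟨q, rfl⟩ : ∃ q', q = q' + 1 := ⟨q - 1, by have := h 0; omega⟩
    have d : ∀ x, HasDerivAt (coxDeBoor t (q + 1) i)
        ((q + 1) * (scaledSpline t q i x - scaledSpline t q (i + 1) x)) x := fun x =>
      coxDeBoor_hasDerivAt ht (by have := h x; omega)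
    rw [Nat.cast_succ, contDiff_succ_iff_deriv]
    refine ⟨fun x => (d x).differentiableAt, by simp, ?_⟩
    rw [funext fun x => (d x).deriv]
    have c1 : ContDiff ℝ n (coxDeBoor t q i) := ih fun x => by
      have := knotMultiplicity_mono (t := t) (q := q) (q' := q + 1) (i := i) (i' := i)
        (by omega) (by omega) x
      have := h x
      omega
    have c2 : ContDiff ℝ n (coxDeBoor t q (i + 1)) := ih fun x => by
      have := knotMultiplicity_mono (t := t) (q := q) (q' := q + 1) (i := i + 1) (i' := i)
        (by omega) (by omega) x
      have := h x
      omega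
    unfold scaledSpline
    fun_prop

/-! ### Knots on a pair of neighbouring elements -/

/-- The knots of two neighbouring elements meeting in `c`: `l` knots of spacing `a` to the left of
`c`, then `r` copies of `c`, then knots of spacing `b` to the right. The subtractions inside the
casts are those of natural numbers, so that at most one of the two terms is nonzero. -/
noncomputable def pairSeq (c a b : ℝ) (l r i : ℕ) : ℝ :=
  c - ((l - i : ℕ) : ℝ) * a + ((i + 1 - (l + r) : ℕ) : ℝ) * b

theorem pairSeq_monotone {a b : ℝ} (ha : 0 ≤ a) (hb : 0 ≤ b) (c : ℝ) (l r : ℕ) :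
    Monotone (pairSeq c a b l r) := by
  intro i i' h
  have h1 : ((l - i' : ℕ) : ℝ) ≤ ((l - i : ℕ) : ℝ) := by exact_mod_cast (by omega)
  have h2 : ((i + 1 - (l + r) : ℕ) : ℝ) ≤ ((i' + 1 - (l + r) : ℕ) : ℝ) := by
    exact_mod_cast (by omega)
  unfold pairSeq
  gcongr

theorem pairSeq_add (c a b : ℝ) (l r i d : ℕ) :
    pairSeq c a b (l + d) r (i + d) = pairSeq c a b l r i := by
  simp only [pairSeq, show l + d - (i + d) = l - i by omega,
    show i + d + 1 - (l + d + r) = i + 1 - (l + r) by omega]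

theorem removeKnot_pairSeq (c a b : ℝ) (l r : ℕ) :
    removeKnot (pairSeq c a b l (r + 1)) l = pairSeq c a b l r := by
  funext i
  simp only [removeKnot, pairSeq]
  split_ifs with h
  · rw [show i + 1 - (l + (r + 1)) = i + 1 - (l + r) by omega]
  · rw [show i + 1 + 1 - (l + (r + 1)) = i + 1 - (l + r) by omega,
      show l - (i + 1) = l - i by omega]

theorem knotMultiplicity_pairSeq_le {a b : ℝ} (ha : 0 < a) (hb : 0 < b) (c : ℝ) (l r q : ℕ)
    (hr : 1 ≤ r) (x : ℝ) : knotMultiplicity (pairSeq c a b l r) q 0 x ≤ r := by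
  have lt : ∀ i i', i < i' → (i < l ∨ l + r ≤ i') →
      pairSeq c a b l r i < pairSeq c a b l r i' := by
    intro i i' h h'
    have m1 := pairSeq_monotone ha.le hb.le c l r (show i + 1 ≤ i' by omega)
    have m2 := pairSeq_monotone ha.le hb.le c l r (show i ≤ i' - 1 by omega)
    rcases h' with h' | h'
    · refine lt_of_lt_of_le ?_ m1
      have h1 : ((l - i : ℕ) : ℝ) = ((l - (i + 1) : ℕ) : ℝ) + 1 := by
        exact_mod_cast (by omega)
      simp only [pairSeq, h1, show i + 1 - (l + r) = 0 by omega,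
        show i + 1 + 1 - (l + r) = 0 by omega]
      nlinarith
    · refine lt_of_le_of_lt m2 ?_
      have h1 : ((i' + 1 - (l + r) : ℕ) : ℝ) = ((i' - 1 + 1 - (l + r) : ℕ) : ℝ) + 1 := by
        exact_mod_cast (by omega)
      simp only [pairSeq, h1, show l - i' = 0 by omega, show l - (i' - 1) = 0 by omega]
      nlinarith
  by_cases hx : ∃ i, (i < l ∨ l + r ≤ i) ∧ pairSeq c a b l r i = x
  · obtain ⟨i, hi, rfl⟩ := hx
    refine (Finset.card_le_one.2 fun j hj j' hj' => ?_).trans hr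
    have e : ∀ j, pairSeq c a b l r j = pairSeq c a b l r i → j = i := by
      intro j hj
      by_contra hne
      rcases Nat.lt_or_gt_of_ne hne with h | h
      · exact (lt j i h (by omega)).ne hj
      · exact (lt i j h (by omega)).ne hj.symm
    rw [e j (Finset.mem_filter.1 hj).2, e j' (Finset.mem_filter.1 hj').2]
  · push Not at hx
    have hs : (Finset.Ico 0 (0 + q + 2)).filter (fun j => pairSeq c a b l r j = x)
        ⊆ Finset.Ico l (l + r) := by
      intro j hj
      rw [Finset.mem_Ico]
      by_contra hne
      exact hx j (by omega) (Finset.mem_filter.1 hj).2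
    exact (Finset.card_le_card hs).trans (by rw [Nat.card_Ico, Nat.add_sub_cancel_left])

/-- Inserting one more copy of the common knot into the knots of a B-spline that has `l + 1` knots to
the left and `n + 1` to the right of it. -/
theorem coxDeBoor_pairSeq_insert {a b : ℝ} (ha : 0 < a) (hb : 0 < b) (c : ℝ) {p l r n : ℕ}
    (h : l + 1 + r + n = p + 1) (x : ℝ) :
    coxDeBoor (pairSeq c a b (l + 1) r) p 0 x =
      (l + 1) * a / ((l + 1) * a + n * b) * coxDeBoor (pairSeq c a b (l + 1) (r + 1)) p 0 x
        + (n + 1) * b / (l * a + (n + 1) * b) * coxDeBoor (pairSeq c a b l (r + 1)) p 0 x := by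
  have mono := pairSeq_monotone ha.le hb.le c (l + 1) (r + 1)
  have key := scaledSpline_removeKnot mono (l + 1) p 0 (by omega) (by omega) x
  have hm := mul_scaledSpline (pairSeq_monotone ha.le hb.le c (l + 1) r) p 0 x
  have h0 : pairSeq c a b (l + 1) (r + 1) 0 = c - (l + 1) * a := by
    simp [pairSeq, show 1 - (l + 1 + (r + 1)) = 0 by omega]
  have h1 : pairSeq c a b (l + 1) (r + 1) 1 = c - l * a := by
    simp [pairSeq, show 1 + 1 - (l + 1 + (r + 1)) = 0 by omega]
  have hc : pairSeq c a b (l + 1) (r + 1) (l + 1) = c := by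
    simp [pairSeq, show l + 1 + 1 - (l + 1 + (r + 1)) = 0 by omega]
  have hp : pairSeq c a b (l + 1) (r + 1) (p + 1) = c + n * b := by
    simp [pairSeq, show p + 1 + 1 - (l + 1 + (r + 1)) = n by omega,
      show l + 1 - (p + 1) = 0 by omega]
  have hq : pairSeq c a b (l + 1) (r + 1) (p + 2) = c + (n + 1) * b := by
    simp [pairSeq, show p + 2 + 1 - (l + 1 + (r + 1)) = n + 1 by omega,
      show l + 1 - (p + 2) = 0 by omega]
  have e0 : pairSeq c a b (l + 1) r 0 = c - (l + 1) * a := by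
    simp [pairSeq, show 1 - (l + 1 + r) = 0 by omega]
  have e1 : pairSeq c a b (l + 1) r (p + 1) = c + (n + 1) * b := by
    simp [pairSeq, show p + 1 + 1 - (l + 1 + r) = n + 1 by omega,
      show l + 1 - (p + 1) = 0 by omega]
  have hs : coxDeBoor (pairSeq c a b (l + 1) (r + 1)) p 1 =
      coxDeBoor (pairSeq c a b l (r + 1)) p 0 :=
    coxDeBoor_congr fun k _ => by rw [add_comm 1 k, zero_add, pairSeq_add]
  rw [removeKnot_pairSeq] at key
  simp only [zero_add] at key hm
  rw [hq, h0, hc] at key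
  rw [e1, e0, key] at hm
  rw [← hm, scaledSpline, scaledSpline, hs]
  simp only [zero_add, show 1 + p + 1 = p + 2 by omega, hp, hq, h0, h1]
  rw [show c - (c - ((l : ℝ) + 1) * a) = (l + 1) * a by ring,
    show c + (n : ℝ) * b - (c - (l + 1) * a) = (l + 1) * a + n * b by ring,
    show c + ((n : ℝ) + 1) * b - c = (n + 1) * b by ring,
    show c + ((n : ℝ) + 1) * b - (c - l * a) = l * a + (n + 1) * b by ring]
  ring

/-! ### Element basis functions in terms of knot sequences -/

theorem bsplineOn_eq_coxDeBoor {p i : ℕ} {Ξ : List ℝ} {f : ℕ → ℝ}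
    (h : ∀ k, k ≤ p + 1 → Ξ[i - 1 + k]? = some (f k)) : bsplineOn p Ξ i = coxDeBoor f p 0 := by
  refine coxDeBoor_congr fun k hk => ?_
  rw [zero_add, List.getD_eq_getElem?_getD, List.getElem?_take_of_lt (by omega),
    List.getElem?_drop, h k hk, Option.getD_some]

theorem innerNodes_getElem? (p : ℕ) (ξ : ℕ → ℝ) (j : ℕ) {i : ℕ} (h : i + 1 < p) :
    (innerNodes p ξ j)[i]? = some (elementNode p ξ j (i + 1)) := by
  simp [innerNodes, List.getElem?_range' (show i < p - 1 by omega), add_comm]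

@[simp] theorem innerNodes_length (p : ℕ) (ξ : ℕ → ℝ) (j : ℕ) :
    (innerNodes p ξ j).length = p - 1 := by
  simp [innerNodes]

theorem elementKnots_getElem? {p : ℕ} (hp : 1 ≤ p) (ξ : ℕ → ℝ) (j : ℕ) {i : ℕ}
    (h : i < 3 * p + 1) :
    (elementKnots p ξ j)[i]? = some (elementNode p ξ j (min (i - p) p)) := by
  have hp' : (p : ℝ) ≠ 0 := by positivity
  unfold elementKnots
  rcases lt_or_ge i (p + 1) with h1 | h1
  · rw [List.append_assoc, List.getElem?_append_left (by simpa using h1),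
      List.getElem?_replicate_of_lt h1, show min (i - p) p = 0 by omega]
    simp [elementNode]
  rcases lt_or_ge i (2 * p) with h2 | h2
  · rw [List.getElem?_append_left (by simp; omega), List.getElem?_append_right (by simpa using h1),
      List.length_replicate, innerNodes_getElem? p ξ j (by omega)]
    congr 2; omega
  · rw [List.getElem?_append_right (by simp; omega), List.getElem?_replicate_of_lt (by simp; omega),
      show min (i - p) p = p by omega]
    simp [elementNode, elementLength, hp']

theorem pairSeq_eq_left {p : ℕ} (hp : 1 ≤ p) (ξ : ℕ → ℝ) (j : ℕ) {b : ℝ} {r i : ℕ}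
    (h : i < p + r) :
    pairSeq (ξ (j + 1)) (elementLength ξ j / p) b p r i = elementNode p ξ j (min i p) := by
  have hp' : (p : ℝ) ≠ 0 := by positivity
  rw [pairSeq, show i + 1 - (p + r) = 0 by omega, show p - i = p - min i p by omega,
    Nat.cast_sub (min_le_right _ _), elementNode]
  simp only [elementLength]
  field_simp
  simp
  ring

theorem pairSeq_eq_right (p : ℕ) (ξ : ℕ → ℝ) (j : ℕ) {a : ℝ} {l r i : ℕ} (h : l ≤ i) :
    pairSeq (ξ j) a (elementLength ξ j / p) l r i = elementNode p ξ j (i + 1 - (l + r)) := by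
  rw [pairSeq, show l - i = 0 by omega, elementNode]
  simp
  ring

theorem pairKnots_getElem? {p : ℕ} (hp : 1 ≤ p) (ξ : ℕ → ℝ) (j : ℕ) {r i : ℕ} (hr : 1 ≤ r)
    (h : i < 2 * p + r) :
    (pairKnots p ξ (j + 1) r)[i]? = some (pairSeq (ξ (j + 1)) (elementLength ξ j / p)
      (elementLength ξ (j + 1) / p) p r i) := by
  unfold pairKnots
  rcases lt_or_ge i p with h1 | h1
  · rw [pairSeq_eq_left hp ξ j (by omega), List.append_assoc,
      List.getElem?_append_left (by simpa using h1), show min i p = i by omega]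
    simp [h1]
  rw [pairSeq_eq_right p ξ (j + 1) h1]
  rcases lt_or_ge i (p + r) with h2 | h2
  · rw [List.getElem?_append_left (by simpa using h2),
      List.getElem?_append_right (by simpa using h1),
      List.getElem?_replicate_of_lt (by simp; omega), show i + 1 - (p + r) = 0 by omega]
    simp [elementNode]
  · rw [List.getElem?_append_right (by simpa using h2)]
    simp only [List.length_append, List.length_map, List.length_range, List.length_replicate,
      List.getElem?_map, List.getElem?_range' (show i - (p + r) < p by omega), Option.map_some]
    congr 2; omega

/-- The element basis functions whose last knot is the right end of the element. -/
theorem elementBasis_left_eq {p : ℕ} (ξ : ℕ → ℝ) (j : ℕ) (b : ℝ) {m : ℕ} (hm : m < p) :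
    elementBasis p ξ j (2 * p - m) =
      coxDeBoor (pairSeq (ξ (j + 1)) (elementLength ξ j / p) b (m + 1) (p + 1 - m)) p 0 := by
  refine bsplineOn_eq_coxDeBoor fun k hk => ?_
  rw [elementKnots_getElem? (by omega) ξ j (by omega),
    ← pairSeq_add _ _ _ (m + 1) (p + 1 - m) k (p - (m + 1)),
    show m + 1 + (p - (m + 1)) = p by omega,
    pairSeq_eq_left (by omega) ξ j (by omega)]
  congr 2; omega

/-- The element basis functions whose first knot is the left end of the element. -/
theorem elementBasis_right_eq {p : ℕ} (ξ : ℕ → ℝ) (j : ℕ) (a : ℝ) {m : ℕ} (hm : m < p) :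
    elementBasis p ξ j (m + 1) =
      coxDeBoor (pairSeq (ξ j) a (elementLength ξ j / p) 0 (p + 1 - m)) p 0 := by
  refine bsplineOn_eq_coxDeBoor fun k hk => ?_
  rw [elementKnots_getElem? (by omega) ξ j (by omega), pairSeq_eq_right p ξ j (by omega)]
  congr 2; omega

/-! ### The recurrence as knot insertion -/

theorem insertionWeight_eq {h h' p : ℝ} (hp : p ≠ 0) (m n : ℕ) :
    insertionWeight h h' m n =
      ((m : ℝ) - n) * (h / p) / (((m : ℝ) - n) * (h / p) + n * (h' / p)) := by
  rw [insertionWeight, show ((m : ℝ) - n) * (h / p) + n * (h' / p) =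
    (((m : ℝ) - n) * h + n * h') / p by ring, ← mul_div_assoc, div_div_div_cancel_right₀ hp]

/-- `B_{m,n}` has `m + 1 - n` knots to the left of the common knot and `p + 1 - m` copies of it.
At `m = p`, the lateral entries of the recurrence are no longer B-splines on these knots. -/
theorem combinedBasis_eq_coxDeBoor {p : ℕ} (hp : 1 ≤ p) (ξ : ℕ → ℝ) (j : ℕ)
    (h1 : 0 < elementLength ξ j) (h2 : 0 < elementLength ξ (j + 1)) {m n : ℕ} (hn : n ≤ m + 1)
    (hm : m < p ∨ m = p ∧ 1 ≤ n ∧ n ≤ m) :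
    combinedBasis p ξ (j + 1) m n =
      coxDeBoor (pairSeq (ξ (j + 1)) (elementLength ξ j / p) (elementLength ξ (j + 1) / p)
        (m + 1 - n) (p + 1 - m)) p 0 := by
  have hp' : (0 : ℝ) < p := by positivity
  induction m generalizing n with
  | zero =>
    unfold combinedBasis inverseInsertion
    split_ifs with h0
    · subst h0
      exact elementBasis_left_eq ξ j _ (m := 0) (by omega)
    · obtain rfl : n = 1 := by omega
      exact elementBasis_right_eq ξ (j + 1) _ (m := 0) (by omega)
  | succ m ih =>
    have lateral0 : combinedBasis p ξ (j + 1) (m + 1) 0 = elementBasis p ξ j (2 * p - (m + 1)) := by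
      simp [combinedBasis, inverseInsertion]
    have lateral1 : combinedBasis p ξ (j + 1) (m + 1) (m + 2) =
        elementBasis p ξ (j + 1) (m + 2) := by
      simp [combinedBasis, inverseInsertion]
    rcases Nat.eq_zero_or_pos n with rfl | hn0
    · rw [lateral0, elementBasis_left_eq ξ j _ (by omega)]
      rfl
    rcases hn.eq_or_lt with rfl | hn1
    · rw [lateral1, elementBasis_right_eq ξ (j + 1) (elementLength ξ j / p) (by omega),
        show m + 1 + 1 - (m + 1 + 1) = 0 by omega]
    have step : combinedBasis p ξ (j + 1) (m + 1) n =
        insertionWeight (elementLength ξ j) (elementLength ξ (j + 1)) (m + 1) (n - 1) •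
            combinedBasis p ξ (j + 1) m (n - 1)
          + (1 - insertionWeight (elementLength ξ j) (elementLength ξ (j + 1)) (m + 1) n) •
            combinedBasis p ξ (j + 1) m n := by
      rw [combinedBasis, inverseInsertion, if_neg (by omega), if_neg (by omega)]
      rfl
    obtain ⟨n, rfl⟩ : ∃ n', n = n' + 1 := ⟨n - 1, by omega⟩
    obtain ⟨l, rfl⟩ : ∃ l, m = n + l := ⟨m - n, by omega⟩
    rw [step, ih (by omega) (by omega), ih (by omega) (by omega), insertionWeight_eq hp'.ne',
      insertionWeight_eq hp'.ne']
    have a0 : 0 < elementLength ξ j / p := by positivity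
    have b0 : 0 < elementLength ξ (j + 1) / p := by positivity
    generalize elementLength ξ j / p = a at *
    generalize elementLength ξ (j + 1) / p = b at *
    obtain ⟨r, hr⟩ : ∃ r, p = n + l + r := ⟨p - (n + l), by omega⟩
    funext x
    simp only [Pi.add_apply, Pi.smul_apply, smul_eq_mul]
    rw [show n + l + 1 + 1 - (n + 1) = l + 1 by omega,
      show n + l + 1 - (n + 1 - 1) = l + 1 by omega,
      show n + l + 1 - (n + 1) = l by omega,
      show p + 1 - (n + l) = r + 1 by omega, show p + 1 - (n + l + 1) = r by omega,
      coxDeBoor_pairSeq_insert (r := r) a0 b0 (ξ (j + 1)) (n := n) (by omega) x]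
    have d : (l : ℝ) * a + (n + 1) * b ≠ 0 := by positivity
    push_cast
    have e1 : (n : ℝ) + l + 1 - n = l + 1 := by ring
    have e2 : (n : ℝ) + l + 1 - (n + 1) = l := by ring
    rw [e1, e2]
    congr 2
    field_simp
    ring

/-! ### Linearity of the recurrence -/

theorem inverseInsertion_eq_zero {a b : ℝ} {V : Type*} [AddCommGroup V] [Module ℝ V]
    {L R : ℕ → V} {m : ℕ} (hL : ∀ i ≤ m, L i = 0) (hR : ∀ i ≤ m, R i = 0) (n : ℕ) :
    inverseInsertion a b L R m n = 0 := by
  induction m generalizing n with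
  | zero =>
    unfold inverseInsertion
    split_ifs
    exacts [hL 0 le_rfl, hR 0 le_rfl]
  | succ m ih =>
    have z := fun n => ih (fun i hi => hL i (by omega)) (fun i hi => hR i (by omega)) n
    unfold inverseInsertion
    split_ifs
    · exact hL _ le_rfl
    · exact hR _ le_rfl
    · rw [z, z, smul_zero, smul_zero, add_zero]

theorem leftCoeff_eq_zero_of_lt {a b : ℝ} {k m : ℕ} (h : m < k) (n : ℕ) :
    leftCoeff a b k m n = 0 :=
  inverseInsertion_eq_zero (fun i hi => if_neg (by omega)) (fun _ _ => rfl) n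

theorem rightCoeff_eq_zero_of_lt {a b : ℝ} {k m : ℕ} (h : m < k) (n : ℕ) :
    rightCoeff a b k m n = 0 :=
  inverseInsertion_eq_zero (fun _ _ => rfl) (fun i hi => if_neg (by omega)) n

theorem inverseInsertion_step {V : Type*} [AddCommGroup V] [Module ℝ V] (a b : ℝ) (L R : ℕ → V)
    {m n : ℕ} (h0 : n ≠ 0) (h1 : n ≠ m + 2) :
    inverseInsertion a b L R (m + 1) n =
      insertionWeight a b (m + 1) (n - 1) • inverseInsertion a b L R m (n - 1)
        + (1 - insertionWeight a b (m + 1) n) • inverseInsertion a b L R m n := by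
  rw [inverseInsertion, if_neg h0, if_neg h1]

/-- The recurrence is linear in its lateral data. -/
theorem inverseInsertion_eq_sum {V : Type*} [AddCommGroup V] [Module ℝ V] (a b : ℝ)
    (L R : ℕ → V) {m N : ℕ} (hN : m < N) (n : ℕ) :
    inverseInsertion a b L R m n =
      ∑ k ∈ Finset.range N, (leftCoeff a b k m n • L k + rightCoeff a b k m n • R k) := by
  induction m generalizing n with
  | zero =>
    simp only [inverseInsertion, leftCoeff, rightCoeff]
    split_ifs <;> simp [ite_smul, hN.ne']
  | succ m ih =>
    by_cases h0 : n = 0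
    · subst h0
      simp [inverseInsertion, leftCoeff, rightCoeff, ite_smul, hN]
    by_cases h1 : n = m + 2
    · subst h1
      simp [inverseInsertion, leftCoeff, rightCoeff, ite_smul, hN]
    · rw [inverseInsertion_step a b L R h0 h1, ih (by omega), ih (by omega), Finset.smul_sum,
        Finset.smul_sum, ← Finset.sum_add_distrib]
      refine Finset.sum_congr rfl fun k _ => ?_
      simp only [leftCoeff, rightCoeff, inverseInsertion_step a b _ _ h0 h1, smul_eq_mul]
      module

theorem combinedBasis_eq_sum (p : ℕ) (ξ : ℕ → ℝ) (j : ℕ) {m n : ℕ} (hn : 1 ≤ n) (hnm : n ≤ m) :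
    combinedBasis p ξ j m n =
      ∑ k ∈ Finset.range m,
        (leftCoeff (elementLength ξ (j - 1)) (elementLength ξ j) k m n
            • elementBasis p ξ (j - 1) (2 * p - k)
          + rightCoeff (elementLength ξ (j - 1)) (elementLength ξ j) k m n
            • elementBasis p ξ j (k + 1)) := by
  obtain ⟨m, rfl⟩ : ∃ m', m = m' + 1 := ⟨m - 1, by omega⟩
  -- the lateral entries of row `m + 1` do not enter its interior
  have hl : leftCoeff (elementLength ξ (j - 1)) (elementLength ξ j) (m + 1) (m + 1) n = 0 := by
    rw [leftCoeff, inverseInsertion_step _ _ _ _ (by omega) (by omega)]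
    have z := leftCoeff_eq_zero_of_lt (a := elementLength ξ (j - 1)) (b := elementLength ξ j)
      (Nat.lt_succ_self m)
    unfold leftCoeff at z
    rw [z, z, smul_zero, smul_zero, add_zero]
  have hr : rightCoeff (elementLength ξ (j - 1)) (elementLength ξ j) (m + 1) (m + 1) n = 0 := by
    rw [rightCoeff, inverseInsertion_step _ _ _ _ (by omega) (by omega)]
    have z := rightCoeff_eq_zero_of_lt (a := elementLength ξ (j - 1)) (b := elementLength ξ j)
      (Nat.lt_succ_self m)
    unfold rightCoeff at z
    rw [z, z, smul_zero, smul_zero, add_zero]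
  rw [combinedBasis, inverseInsertion_eq_sum _ _ _ _ (Nat.lt_succ_self (m + 1)) n,
    Finset.sum_range_succ, hl, hr]
  simp

/-! ### The combined functions as smooth B-splines -/

theorem combinedBasis_contDiff {p : ℕ} (hp : 1 ≤ p) (ξ : ℕ → ℝ) (j : ℕ)
    (h1 : 0 < elementLength ξ j) (h2 : 0 < elementLength ξ (j + 1)) {m n : ℕ} (hm : m ≤ p)
    (hn : 1 ≤ n) (hnm : n ≤ m) :
    ContDiff ℝ ((m - 1 : ℕ) : WithTop ℕ∞) (combinedBasis p ξ (j + 1) m n) := by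
  have hp' : (0 : ℝ) < p := by positivity
  have a0 : 0 < elementLength ξ j / p := by positivity
  have b0 : 0 < elementLength ξ (j + 1) / p := by positivity
  rw [combinedBasis_eq_coxDeBoor hp ξ j h1 h2 (by omega) (by omega)]
  refine coxDeBoor_contDiff (pairSeq_monotone a0.le b0.le _ _ _) fun x => ?_
  have := knotMultiplicity_pairSeq_le a0 b0 (ξ (j + 1)) (m + 1 - n) (p + 1 - m) p (by omega) x
  omega

theorem combinedBasis_eq_bsplineOn {p : ℕ} (hp : 1 ≤ p) (ξ : ℕ → ℝ) (j : ℕ)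
    (h1 : 0 < elementLength ξ j) (h2 : 0 < elementLength ξ (j + 1)) {m n : ℕ} (hm : m ≤ p)
    (hn : 1 ≤ n) (hnm : n ≤ m) :
    combinedBasis p ξ (j + 1) m n =
      bsplineOn p (pairKnots p ξ (j + 1) (p - m + 1)) (p - m + n) := by
  rw [combinedBasis_eq_coxDeBoor hp ξ j h1 h2 (by omega) (by omega), eq_comm]
  refine bsplineOn_eq_coxDeBoor fun k hk => ?_
  rw [pairKnots_getElem? hp ξ j (by omega) (by omega),
    ← pairSeq_add _ _ _ (m + 1 - n) _ k (p - m + n - 1)]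
  congr 2 <;> omega

/-! ### Windows of the global knot vector -/

/-- A B-spline whose knots lie in a block of the knot vector is determined by that block. -/
theorem bsplineOn_append {p i : ℕ} {A Y C : List ℝ} (hi : 1 ≤ i) (h : i + (p + 1) ≤ Y.length) :
    bsplineOn p (A ++ Y ++ C) (A.length + i) = bsplineOn p Y i := by
  unfold bsplineOn
  rw [List.append_assoc, show A.length + i - 1 = A.length + (i - 1) by omega,
    List.drop_length_add_append, List.drop_append_of_le_length (by omega),
    List.take_append_of_le_length (by rw [List.length_drop]; omega)]

theorem globalKnots_succ (p : ℕ) (ξ : ℕ → ℝ) (r : ℕ → ℕ) (j : ℕ) :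
    globalKnots p (j + 2) ξ r = globalKnots p (j + 1) ξ r ++
      (innerNodes p ξ (j + 1) ++ List.replicate (r (j + 2)) (ξ (j + 2))) := by
  simp [globalKnots, List.range'_concat, add_comm 1]

theorem globalKnots_length_succ (p : ℕ) (ξ : ℕ → ℝ) (r : ℕ → ℕ) (j : ℕ) :
    (globalKnots p (j + 2) ξ r).length =
      (globalKnots p (j + 1) ξ r).length + (p - 1) + r (j + 2) := by
  simp [globalKnots_succ, add_assoc]

theorem globalKnots_prefix (p : ℕ) (ξ : ℕ → ℝ) (r : ℕ → ℕ) (j d : ℕ) :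
    ∃ C, globalKnots p (j + 1 + d) ξ r = globalKnots p (j + 1) ξ r ++ C := by
  induction d with
  | zero => exact ⟨[], by simp⟩
  | succ d ih =>
    obtain ⟨C, hC⟩ := ih
    refine ⟨C ++ (innerNodes p ξ (j + d + 1) ++
      List.replicate (r (j + d + 2)) (ξ (j + d + 2))), ?_⟩
    rw [show j + 1 + (d + 1) = j + d + 2 by omega, globalKnots_succ,
      show j + d + 1 = j + 1 + d by omega, hC, List.append_assoc]

/-- The knots up to `ξ_{j+1}` end with all the copies of `ξ_{j+1}`. -/
theorem globalKnots_suffix (p : ℕ) (ξ : ℕ → ℝ) (r : ℕ → ℕ) (j : ℕ) :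
    ∃ A, globalKnots p (j + 1) ξ r = A ++ List.replicate (r (j + 1)) (ξ (j + 1)) := by
  cases j with
  | zero => exact ⟨[], by simp [globalKnots]⟩
  | succ j => exact ⟨_, by rw [globalKnots_succ, ← List.append_assoc]⟩

/-- A B-spline on the global knot vector whose knots lie in one closed element. -/
theorem bsplineOn_globalKnots_element {p M : ℕ} {ξ : ℕ → ℝ} {r : ℕ → ℕ} {j i g : ℕ}
    (hj : j + 2 ≤ M) (hr1 : r (j + 1) ≤ p + 1) (hr2 : r (j + 2) ≤ p + 1) (hp : 1 ≤ p)
    (hi : p + 2 ≤ i + r (j + 1)) (hi' : i + 1 ≤ p + r (j + 2))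
    (hg : g + (p + 1) = (globalKnots p (j + 1) ξ r).length + i) :
    bsplineOn p (globalKnots p M ξ r) g = elementBasis p ξ (j + 1) i := by
  obtain ⟨d, rfl⟩ : ∃ d, M = j + 1 + 1 + d := ⟨M - (j + 2), by omega⟩
  obtain ⟨C, hC⟩ := globalKnots_prefix p ξ r (j + 1) d
  obtain ⟨A, hA⟩ := globalKnots_suffix p ξ r j
  have e1 : globalKnots p (j + 1 + 1 + d) ξ r = A ++ (List.replicate (r (j + 1)) (ξ (j + 1)) ++
      innerNodes p ξ (j + 1) ++ List.replicate (r (j + 2)) (ξ (j + 2))) ++ C := by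
    rw [hC, globalKnots_succ, hA]
    simp only [List.append_assoc]
  have e2 : elementKnots p ξ (j + 1) = List.replicate (p + 1 - r (j + 1)) (ξ (j + 1)) ++
      (List.replicate (r (j + 1)) (ξ (j + 1)) ++
        innerNodes p ξ (j + 1) ++ List.replicate (r (j + 2)) (ξ (j + 2))) ++
      List.replicate (p + 1 - r (j + 2)) (ξ (j + 2)) := by
    have s1 : List.replicate (p + 1) (ξ (j + 1)) = List.replicate (p + 1 - r (j + 1)) (ξ (j + 1)) ++
        List.replicate (r (j + 1)) (ξ (j + 1)) := by
      rw [List.replicate_append_replicate, Nat.sub_add_cancel hr1]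
    have s2 : List.replicate (p + 1) (ξ (j + 2)) = List.replicate (r (j + 2)) (ξ (j + 2)) ++
        List.replicate (p + 1 - r (j + 2)) (ξ (j + 2)) := by
      rw [List.replicate_append_replicate, Nat.add_sub_cancel' hr2]
    rw [elementKnots, s1, s2]
    simp only [List.append_assoc]
  rw [hA, List.length_append, List.length_replicate] at hg
  obtain ⟨i', rfl⟩ : ∃ i', i = (p + 1 - r (j + 1)) + i' := ⟨i - (p + 1 - r (j + 1)), by omega⟩
  obtain rfl : g = A.length + i' := by omega
  have hl : i' + (p + 1) ≤ (List.replicate (r (j + 1)) (ξ (j + 1)) ++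
      innerNodes p ξ (j + 1) ++ List.replicate (r (j + 2)) (ξ (j + 2))).length := by
    simp
    omega
  have key := bsplineOn_append (A := List.replicate (p + 1 - r (j + 1)) (ξ (j + 1)))
    (C := List.replicate (p + 1 - r (j + 2)) (ξ (j + 2))) (by omega) hl
  rw [List.length_replicate, ← e2] at key
  rw [e1, bsplineOn_append (by omega) hl, elementBasis, key]

theorem pairKnots_eq {p : ℕ} (hp : 1 ≤ p) (ξ : ℕ → ℝ) (j r : ℕ) :
    pairKnots p ξ (j + 1) r = ξ j :: (innerNodes p ξ j ++ List.replicate r (ξ (j + 1)) ++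
      innerNodes p ξ (j + 1) ++ [ξ (j + 2)]) := by
  obtain ⟨p, rfl⟩ : ∃ p', p = p' + 1 := ⟨p - 1, by omega⟩
  have hp' : (p : ℝ) + 1 ≠ 0 := by positivity
  rw [pairKnots, List.range_eq_range', List.range'_succ, List.range'_concat]
  simp [innerNodes, elementNode, elementLength]
  field_simp
  ring_nf

/-- A B-spline on the global knot vector whose knots lie in two neighbouring closed elements, with
each outer end of the pair occurring at most once. -/
theorem bsplineOn_globalKnots_pair {p M : ℕ} {ξ : ℕ → ℝ} {r : ℕ → ℕ} {j i g : ℕ}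
    (hj : j + 3 ≤ M) (hr1 : 1 ≤ r (j + 1)) (hr3 : 1 ≤ r (j + 3)) (hp : 1 ≤ p)
    (hi : 1 ≤ i) (hi' : i + 1 ≤ p + r (j + 2))
    (hg : g + 1 = (globalKnots p (j + 1) ξ r).length + i) :
    bsplineOn p (globalKnots p M ξ r) g = bsplineOn p (pairKnots p ξ (j + 2) (r (j + 2))) i := by
  obtain ⟨d, rfl⟩ : ∃ d, M = j + 2 + 1 + d := ⟨M - (j + 3), by omega⟩
  obtain ⟨C, hC⟩ := globalKnots_prefix p ξ r (j + 2) d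
  obtain ⟨A, hA⟩ := globalKnots_suffix p ξ r j
  obtain ⟨s, hs⟩ : ∃ s, r (j + 1) = s + 1 := ⟨r (j + 1) - 1, by omega⟩
  obtain ⟨s', hs'⟩ : ∃ s, r (j + 3) = s + 1 := ⟨r (j + 3) - 1, by omega⟩
  have e1 : globalKnots p (j + 2 + 1 + d) ξ r = (A ++ List.replicate s (ξ (j + 1))) ++
      pairKnots p ξ (j + 2) (r (j + 2)) ++ (List.replicate s' (ξ (j + 3)) ++ C) := by
    rw [hC, globalKnots_succ p ξ r (j + 1), globalKnots_succ p ξ r j, hA, pairKnots_eq hp, hs,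
      List.replicate_succ', show j + 1 + 2 = j + 3 by omega, hs', List.replicate_succ]
    simp only [List.append_assoc, List.cons_append, List.nil_append]
  rw [hA, hs, List.length_append, List.length_replicate] at hg
  have hl : i + (p + 1) ≤ (pairKnots p ξ (j + 2) (r (j + 2))).length := by
    simp [pairKnots]
    omega
  have e2 : g = (A ++ List.replicate s (ξ (j + 1))).length + i := by
    simp
    omega
  rw [e1, e2, bsplineOn_append hi hl]

/-- The case of a B-spline on the global knot vector that starts before the last copy of
`ξ_{J+1}`. Those with `J = 0` are `B_{K_1,i}` with `i ≤ p`; for `J ≥ 1`, those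
starting at or after the last copy of `ξ_J` form the family attached to `ξ_{J+1}`. -/
theorem bsplineOn_globalKnots_mem {p M : ℕ} (hp : 1 ≤ p) {ξ : ℕ → ℝ} {r : ℕ → ℕ}
    (hpos : ∀ j, j + 2 ≤ M → 0 < elementLength ξ (j + 1)) (h1 : r 1 = p + 1)
    (hr : ∀ j, j + 3 ≤ M → 1 ≤ r (j + 2) ∧ r (j + 2) ≤ p)
    (bound : ∀ j, j + 1 ≤ M → 1 ≤ r (j + 1) ∧ r (j + 1) ≤ p + 1)
    {J i : ℕ} (hJ : J + 2 ≤ M) (hi : 1 ≤ i) (hiJ : i + 1 ≤ (globalKnots p (J + 1) ξ r).length) :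
    bsplineOn p (globalKnots p M ξ r) i ∈
      elementBasis p ξ 1 '' Set.Icc 1 p ∪ ⋃ j ∈ Set.Icc 2 (M - 1), knotBasis p ξ j (r j) := by
  induction J with
  | zero =>
    have hl : (globalKnots p 1 ξ r).length = p + 1 := by simp [globalKnots, h1]
    rw [zero_add, hl] at hiJ
    have b2 : 1 ≤ r 2 ∧ r 2 ≤ p + 1 := bound 1 (by omega)
    refine Or.inl ⟨i, ⟨hi, by omega⟩, ?_⟩
    exact (bsplineOn_globalKnots_element (j := 0) (by omega) (by simp [h1]) b2.2 hp
      (by rw [zero_add, h1]; omega) (by rw [zero_add]; omega) (by rw [zero_add, hl]; omega)).symm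
  | succ J ih =>
    rcases lt_or_ge i (globalKnots p (J + 1) ξ r).length with hlt | hge
    · exact ih (by omega) hlt
    have hl := globalKnots_length_succ p ξ r J
    rw [show J + 1 + 1 = J + 2 by omega, hl] at hiJ
    have b1 := bound J (by omega)
    have b2 := hr J (by omega)
    have b3 : 1 ≤ r (J + 1 + 2) ∧ r (J + 1 + 2) ≤ p + 1 := bound (J + 2) (by omega)
    have b4 : 1 ≤ r (J + 1 + 1) ∧ r (J + 1 + 1) ≤ p := b2
    have e4 : r (J + 1 + 1) = r (J + 2) := rfl
    refine Or.inr (Set.mem_biUnion (x := J + 2) ⟨by omega, by omega⟩ ?_)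
    obtain ⟨l, rfl⟩ : ∃ l, i = (globalKnots p (J + 1) ξ r).length + l :=
      ⟨_, (Nat.add_sub_cancel' hge).symm⟩
    -- the knots lie in the left element, in both, or in the right one
    rcases lt_or_ge (l + 1) (r (J + 2)) with hA | hA
    · refine Or.inl (Or.inl ⟨p + l + 1, ⟨by omega, by omega⟩, ?_⟩)
      exact (bsplineOn_globalKnots_element (j := J) (by omega) (by omega) (by omega) hp (by omega)
        (by omega) (by omega)).symm
    rcases lt_or_ge l p with hB | hB
    · refine Or.inl (Or.inr ⟨l + 2 - r (J + 2), ⟨by omega, by omega⟩, ?_⟩)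
      rw [combinedBasis_eq_bsplineOn hp ξ (J + 1) (hpos J (by omega)) (hpos (J + 1) (by omega))
        (by omega) (by omega) (by omega), show p - (p - r (J + 2) + 1) + 1 = r (J + 2) by omega,
        show p - (p - r (J + 2) + 1) + (l + 2 - r (J + 2)) = l + 1 by omega]
      exact (bsplineOn_globalKnots_pair (by omega) (by omega) b3.1 hp (by omega) (by omega)
        (by omega)).symm
    · refine Or.inr ⟨l + 2 - r (J + 2), ⟨by omega, by omega⟩, ?_⟩
      refine (bsplineOn_globalKnots_element (j := J + 1) (by omega) (by omega) b3.2 hp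
        (by omega) (by omega) ?_).symm
      rw [show J + 1 + 1 = J + 2 by omega, hl]
      omega

theorem mainTheorem1 (p M : ℕ) (hp : 1 ≤ p) (hM : 2 ≤ M)
    (ξ : ℕ → ℝ) (hξ : StrictMonoOn ξ (Set.Icc 1 M)) :
    -- two neighbouring elements `K_{j-1}` and `K_j`
    (∀ j, 2 ≤ j → j + 1 ≤ M → ∀ m n, 1 ≤ m → m ≤ p → 1 ≤ n → n ≤ m →
      -- smoothness, also across the common knot `ξ_j`
      ContDiff ℝ ((m - 1 : ℕ) : WithTop ℕ∞) (combinedBasis p ξ j m n) ∧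
      -- `B_{m,n,j}` is a B-spline of degree `p`
      combinedBasis p ξ j m n = bsplineOn p (pairKnots p ξ j (p - m + 1)) (p - m + n) ∧
      -- it is a linear combination of element basis functions
      combinedBasis p ξ j m n =
        ∑ k ∈ Finset.range m,
          (leftCoeff (elementLength ξ (j - 1)) (elementLength ξ j) k m n
              • elementBasis p ξ (j - 1) (2 * p - k)
            + rightCoeff (elementLength ξ (j - 1)) (elementLength ξ j) k m n
              • elementBasis p ξ j (k + 1))) ∧
    -- the B-spline basis of the global open knot vector
    (∀ r : ℕ → ℕ, r 1 = p + 1 → r M = p + 1 →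
      (∀ j, 2 ≤ j → j + 1 ≤ M → 1 ≤ r j ∧ r j ≤ p) →
      bsplineSet p (globalKnots p M ξ r) =
        elementBasis p ξ 1 '' Set.Icc 1 p
          ∪ (⋃ j ∈ Set.Icc 2 (M - 1), knotBasis p ξ j (r j))
          ∪ elementBasis p ξ (M - 1) '' Set.Icc (p + 1) (2 * p)) := by
  have hpos : ∀ j, j + 2 ≤ M → 0 < elementLength ξ (j + 1) := fun j hj =>
    sub_pos.2 (hξ ⟨by omega, by omega⟩ ⟨by omega, by omega⟩ (by omega))
  refine ⟨fun j hj hjM m n _ hm hn hnm => ?_, fun r h1 hrM hr => ?_⟩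
  · obtain ⟨j, rfl⟩ : ∃ j', j = j' + 2 := ⟨j - 2, by omega⟩
    have a0 := hpos j (by omega)
    have b0 := hpos (j + 1) (by omega)
    exact ⟨combinedBasis_contDiff hp ξ (j + 1) a0 b0 hm hn hnm,
      combinedBasis_eq_bsplineOn hp ξ (j + 1) a0 b0 hm hn hnm,
      combinedBasis_eq_sum p ξ (j + 2) hn hnm⟩
  obtain ⟨N, rfl⟩ : ∃ N, M = N + 2 := ⟨M - 2, by omega⟩
  have hl := globalKnots_length_succ p ξ r N
  have hl1 : (globalKnots p 1 ξ r).length = p + 1 := by simp [globalKnots, h1]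
  have bound : ∀ j, j ≤ N + 1 → 1 ≤ r (j + 1) ∧ r (j + 1) ≤ p + 1 := by
    intro j hj
    rcases hj.eq_or_lt with rfl | hj
    · exact ⟨hrM.symm ▸ Nat.le_add_left 1 p, hrM.le⟩
    · rcases Nat.eq_zero_or_pos j with rfl | hj0
      · exact ⟨by rw [zero_add]; omega, h1.le⟩
      · have := hr (j + 1) (by omega) (by omega)
        omega
  have len_mono : ∀ j d, (globalKnots p (j + 1) ξ r).length ≤
      (globalKnots p (j + 1 + d) ξ r).length := by
    intro j d
    obtain ⟨C, hC⟩ := globalKnots_prefix p ξ r j d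
    simp [hC]
  have elem : ∀ j i g, j ≤ N → p + 2 ≤ i + r (j + 1) → i + 1 ≤ p + r (j + 2) →
      g + (p + 1) = (globalKnots p (j + 1) ξ r).length + i →
      bsplineOn p (globalKnots p (N + 2) ξ r) g = elementBasis p ξ (j + 1) i :=
    fun j i g hj h h' hg => bsplineOn_globalKnots_element (by omega) (bound j (by omega)).2
      (bound (j + 1) (by omega)).2 hp h h' hg
  ext B
  constructor
  · rintro ⟨i, hi, hiN, rfl⟩
    rcases lt_or_ge i (globalKnots p (N + 1) ξ r).length with hlt | hge
    · exact Or.inl (bsplineOn_globalKnots_mem hp hpos h1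
        (fun j hj => hr (j + 2) (by omega) (by omega)) (fun j hj => bound j (by omega))
        (by omega) hi hlt)
    · have b := bound N (by omega)
      exact Or.inr ⟨i + (p + 1) - (globalKnots p (N + 1) ξ r).length, ⟨by omega, by omega⟩,
        (elem N _ i le_rfl (by omega) (by omega) (by omega)).symm⟩
  · have g1 := len_mono 0 N
    have g2 := len_mono 0 (N + 1)
    rw [zero_add, hl1] at g1 g2
    rw [show 1 + (N + 1) = N + 2 by omega] at g2
    rw [add_comm 1 N] at g1
    rintro ((⟨i, ⟨hi, hi'⟩, rfl⟩ | hB) | ⟨i, ⟨hi, hi'⟩, rfl⟩)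
    · have b : 1 ≤ r 2 ∧ r 2 ≤ p + 1 := bound 1 (by omega)
      exact ⟨i, hi, by omega,
        (elem 0 i i (by omega) (by rw [zero_add]; omega) (by rw [zero_add]; omega)
          (by rw [zero_add, hl1]; omega)).symm⟩
    · simp only [Set.mem_iUnion] at hB
      obtain ⟨j, ⟨hj, hj'⟩, hB⟩ := hB
      obtain ⟨j, rfl⟩ : ∃ j', j = j' + 2 := ⟨j - 2, by omega⟩
      have b1 := bound j (by omega)
      have b2 := hr (j + 2) (by omega) (by omega)
      have b3 := bound (j + 2) (by omega)
      have l1 := globalKnots_length_succ p ξ r j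
      have l2 := globalKnots_length_succ p ξ r (j + 1)
      have l3 := len_mono (j + 2) (N - (j + 1))
      have l4 := len_mono 0 j
      have l5 := len_mono (j + 1) (N - (j + 1))
      rw [show j + 2 + 1 + (N - (j + 1)) = N + 2 by omega] at l3
      rw [show j + 1 + 1 + (N - (j + 1)) = N + 1 by omega] at l5
      rw [zero_add, hl1, add_comm 1 j] at l4
      simp only [show j + 1 + 1 = j + 2 by omega, show j + 1 + 2 = j + 3 by omega] at l2 l3 l5 b3
      rcases hB with (⟨i, ⟨hi, hi'⟩, rfl⟩ | ⟨n, ⟨hn, hn'⟩, rfl⟩) | ⟨i, ⟨hi, hi'⟩, rfl⟩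
      · exact ⟨(globalKnots p (j + 1) ξ r).length + i - (p + 1), by omega, by omega,
          (elem j i _ (by omega) (by omega) (by omega) (by omega)).symm⟩
      · refine ⟨(globalKnots p (j + 1) ξ r).length + (r (j + 2) - 1 + n) - 1, by omega, by omega,
          ?_⟩
        rw [combinedBasis_eq_bsplineOn hp ξ (j + 1) (hpos j (by omega)) (hpos (j + 1) (by omega))
          (by omega) (by omega) (by omega), show p - (p - r (j + 2) + 1) + 1 = r (j + 2) by omega,
          show p - (p - r (j + 2) + 1) + n = r (j + 2) - 1 + n by omega]
        exact (bsplineOn_globalKnots_pair (by omega) (by omega) b3.1 hp (by omega) (by omega)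
          (by omega)).symm
      · refine ⟨(globalKnots p (j + 2) ξ r).length + i - (p + 1), by omega, by omega,
          (elem (j + 1) i _ (by omega) ?_ ?_ ?_).symm⟩
        all_goals simp only [show j + 1 + 1 = j + 2 by omega, show j + 1 + 2 = j + 3 by omega]
        all_goals omega
    · have b := bound N (by omega)
      exact ⟨(globalKnots p (N + 1) ξ r).length + i - (p + 1), by omega, by omega,
        (elem N i _ le_rfl (by omega) (by omega) (by omega)).symm⟩
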